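/- A \emph{colored graph} $X=(V,E,c)$ is a finite simple undirected graph $(V,E)$ with a coloring $c$ of its vertices; an \emph{automorphism} of $X$ is a permutation of $V$ that preserves adjacency, non-adjacency and colors. A set $S\subseteq V$ is a \emph{fixing set} for $X$ if the identity is the only automorphism of $X$ that fixes every vertex of $S$. The problem $(n-k)$-\textsc{Rigid} is: given a colored graph $X$ on $n$ vertices and a number $k\in\mathbb{N}$ (the parameter), decide whether $X$ has a fixing set consisting of exactly $n-k$ vertices (for $k>n$ the answer is no). \textbf{Theorem.} There is a $k^{O(k^2)}\,n^{O(1)}$ time algorithm for $(n-k)$-\textsc{Rigid}. That is, there are a single program for a deterministic random access machine (unit cost, with addition, truncated subtraction, tests for zero, and direct and indirect memory access on natural numbers) and a constant $C\in\mathbb{N}$ such that, for all $n,k\in\mathbb{N}$ and every colored graph $X$ with vertex set $\{0,\dots,n-1\}$ and colors in $\mathbb{N}$, the program, given $n$, $k$, the list of colors and the adjacency matrix of $X$, halts within $C\cdot k^{Ck^2}\cdot(n+1)^{C}$ steps (where $0^0=1$) with output $1$ if $X$ has a fixing set of exactly $n-k$ vertices, and with output $0$ otherwise. -/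

import Mathlib

/-! ### Vertex-colored graphs and fixing sets -/

namespace ColoredGraph

/-- `π` is an automorphism of the graph `G` with vertex coloring `c`: it preserves edges
(and non-edges) and colors. -/
def IsAut {V : Type*} {γ : Type*} (G : SimpleGraph V) (c : V → γ) (π : Equiv.Perm V) : Prop :=
  (∀ u v : V, G.Adj (π u) (π v) ↔ G.Adj u v) ∧ ∀ v : V, c (π v) = c v

/-- `S` is a fixing set: the only automorphism fixing every vertex of `S` is the identity. -/
def IsFixingSet {V : Type*} {γ : Type*} (G : SimpleGraph V) (c : V → γ) (S : Finset V) : Prop :=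
  ∀ π : Equiv.Perm V, IsAut G c π → (∀ v ∈ S, π v = v) → π = 1

/-- The question of the problem `(n-k)`-Rigid: is there a fixing set consisting of all
but `k` vertices?  (For `k > n` there is no set with `n - k` vertices, so the answer is no.) -/
def NSubKRigid {V : Type*} [Fintype V] {γ : Type*} (G : SimpleGraph V) (c : V → γ) (k : ℕ) :
    Prop :=
  ∃ S : Finset V, S.card + k = Fintype.card V ∧ IsFixingSet G c S

end ColoredGraph

/-! ### Random access machines

Structured programs over unboundedly large memory, with natural numbers as cell contents.  The
only arithmetic operations are addition and truncated subtraction; every arithmetic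
operation, literal, register or memory access, and every instruction or test takes one unit of
time.  (Multiplication is not primitive, so within `t` steps numbers grow by at most a factor
`2 ^ O(t)`, and the unit-cost measure is polynomially related to Turing machine time.) -/

namespace RAM

/-- The state of a machine: scalar registers, and arrays `mem a` of unbounded length.
A program names finitely many of each; the cells of an array are addressed indirectly. -/
structure State where
  reg : ℕ → ℕ
  mem : ℕ → ℕ → ℕ

/-- Expressions: literals, registers, array cells `a[e]`, sums and truncated differences. -/
inductive Expr where
  | lit (m : ℕ)
  | reg (i : ℕ)
  | load (a : ℕ) (e : Expr)
  | add (e f : Expr)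
  | sub (e f : Expr)

/-- The value of an expression. -/
def Expr.eval (s : State) : Expr → ℕ
  | .lit m => m
  | .reg i => s.reg i
  | .load a e => s.mem a (e.eval s)
  | .add e f => e.eval s + f.eval s
  | .sub e f => e.eval s - f.eval s

/-- The time for evaluating an expression: one unit for each of its nodes. -/
def Expr.cost : Expr → ℕ
  | .lit _ => 1
  | .reg _ => 1
  | .load _ e => e.cost + 1
  | .add e f => e.cost + f.cost + 1
  | .sub e f => e.cost + f.cost + 1

/-- Programs.  A test succeeds if the value of the expression is nonzero (so that `x < y` is
tested by the expression `y - x`). -/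
inductive Prog where
  | skip
  | assign (i : ℕ) (e : Expr)
  | store (a : ℕ) (e f : Expr)
  | seq (p q : Prog)
  | ite (e : Expr) (p q : Prog)
  | loop (e : Expr) (p : Prog)

/-- The state after register `i` is set to `x`. -/
def State.setReg (s : State) (i x : ℕ) : State :=
  { s with reg := Function.update s.reg i x }

/-- The state after cell `j` of array `a` is set to `x`. -/
def State.setMem (s : State) (a j x : ℕ) : State :=
  { s with mem := Function.update s.mem a (Function.update (s.mem a) j x) }

/-- `Exec p s t s'`: started in state `s`, the program `p` halts after exactly `t` units of time,
in state `s'`. -/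
inductive Exec : Prog → State → ℕ → State → Prop where
  | skip (s : State) : Exec .skip s 1 s
  | assign (s : State) (i : ℕ) (e : Expr) :
      Exec (.assign i e) s (e.cost + 1) (s.setReg i (e.eval s))
  | store (s : State) (a : ℕ) (e f : Expr) :
      Exec (.store a e f) s (e.cost + f.cost + 1) (s.setMem a (e.eval s) (f.eval s))
  | seq {p q : Prog} {s s' s'' : State} {t t' : ℕ} :
      Exec p s t s' → Exec q s' t' s'' → Exec (.seq p q) s (t + t') s''
  | iteTrue {e : Expr} {p q : Prog} {s s' : State} {t : ℕ} :
      e.eval s ≠ 0 → Exec p s t s' → Exec (.ite e p q) s (e.cost + 1 + t) s'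
  | iteFalse {e : Expr} {p q : Prog} {s s' : State} {t : ℕ} :
      e.eval s = 0 → Exec q s t s' → Exec (.ite e p q) s (e.cost + 1 + t) s'
  | loopDone {e : Expr} {p : Prog} {s : State} :
      e.eval s = 0 → Exec (.loop e p) s (e.cost + 1) s
  | loopStep {e : Expr} {p : Prog} {s s' s'' : State} {t t' : ℕ} :
      e.eval s ≠ 0 → Exec p s t s' → Exec (.loop e p) s' t' s'' →
      Exec (.loop e p) s (e.cost + 1 + t + t') s''

/-- Programs are deterministic: a halting computation has a unique running time and result. -/
theorem Exec.deterministic {p : Prog} {s : State} {t₁ t₂ : ℕ} {s₁ s₂ : State}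
    (h₁ : Exec p s t₁ s₁) (h₂ : Exec p s t₂ s₂) : t₁ = t₂ ∧ s₁ = s₂ := by
  induction h₁ generalizing t₂ s₂ with
  | skip | assign | store => cases h₂; exact ⟨rfl, rfl⟩
  | seq _ _ ih ih' =>
    cases h₂ with
    | seq a b =>
      obtain ⟨rfl, rfl⟩ := ih a
      obtain ⟨rfl, rfl⟩ := ih' b
      exact ⟨rfl, rfl⟩
  | iteTrue he _ ih =>
    cases h₂ with
    | iteTrue _ a => obtain ⟨rfl, rfl⟩ := ih a; exact ⟨rfl, rfl⟩
    | iteFalse he' _ => exact absurd he' he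
  | iteFalse he _ ih =>
    cases h₂ with
    | iteTrue he' _ => exact absurd he he'
    | iteFalse _ a => obtain ⟨rfl, rfl⟩ := ih a; exact ⟨rfl, rfl⟩
  | loopDone he =>
    cases h₂ with
    | loopDone _ => exact ⟨rfl, rfl⟩
    | loopStep he' _ _ => exact absurd he he'
  | loopStep he _ _ ih ih' =>
    cases h₂ with
    | loopDone he' => exact absurd he' he
    | loopStep _ a b =>
      obtain ⟨rfl, rfl⟩ := ih a
      obtain ⟨rfl, rfl⟩ := ih' b
      exact ⟨rfl, rfl⟩

open Classical in
/-- The initial state for the instance `(G, c, k)` on the vertices `0, …, n - 1`: register `0`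
holds `n`, register `1` holds `k`, array `0` lists the colors of the vertices, array `1` is
the adjacency matrix of `G` row by row, and everything else is `0`. -/
noncomputable def inputState {n : ℕ} (G : SimpleGraph (Fin n)) (c : Fin n → ℕ) (k : ℕ) :
    State where
  reg i := if i = 0 then n else if i = 1 then k else 0
  mem a j :=
    if a = 0 then (if h : j < n then c ⟨j, h⟩ else 0)
    else if a = 1 then
      (if ∃ u v : Fin n, j = u.val * n + v.val ∧ G.Adj u v then 1 else 0)
    else 0

/-- Started on the instance `(G, c, k)`, the program `p` halts within `T` units of time and leaves
`1` in register `0` if the statement `P` is true, and `0` if it is false. -/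
def DecidesWithin (p : Prog) {n : ℕ} (G : SimpleGraph (Fin n)) (c : Fin n → ℕ) (k : ℕ)
    (P : Prop) (T : ℕ) : Prop :=
  ∃ (t : ℕ) (s : State), Exec p (inputState G c k) t s ∧ t ≤ T ∧
    (P → s.reg 0 = 1) ∧ (¬ P → s.reg 0 = 0)

end RAM

/-! Pass to complements: the question is whether some set `K` of `k` vertices is free, that is,
contains the support of no nontrivial automorphism. Call two vertices twins if transposing them is
an automorphism. A free set has no two distinct twins, and replacing a member by a twin keeps it
free, so only the least vertex of each twin class matters (`exists_isFree_forall_not_isAut_swap`).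

If there are more than `k ^ k + k` such representatives, the answer is yes, and a free `k`-set
exists among the first `k ^ k + k` of them. It is built greedily: if a free `K` cannot be extended
by `b`, some automorphism moves `b` and otherwise only points of `K`. Two such `b`, `b'` whose
automorphisms act alike on `K` give a 3-cycle, which makes `b` and `b'` twins
(`isAut_swap_of_agree`). So distinct representatives have distinct actions, and at most `(|K| + 1) ^
|K|` of them are bad (`exists_isFree_insert`).

At most `k ^ k + k` candidate vertices thus remain. All `k`-tuples of candidates are tried, and for
each tuple all `k ^ k` self-maps of its index set, testing whether the induced map is a nontrivial
automorphism of the whole graph.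

The program is obtained from a calculus. `Cmp` asserts a program with running time a fixed power of
a scale, for every allocation of variables to registers; variables are named by the functions they
hold. The class is closed under intermediate results and under iteration up to the scale, hence
under bounded quantifiers, search and arithmetic. With scale `(n + 1) * (k ^ k + k + 1) ^ (k + 1)`,
polynomial time in the scale is the claimed bound. -/

/-! ### A calculus of functions computed by random access machines -/

namespace RAM

/-- A computation context: the values `a : α` satisfying `ok` are described by variables held in
registers and by the read-only memory `mem a`; `bd a` is the scale in which time is measured. -/
structure Ctx (α : Type) where
  vars : Set (α → ℕ)
  mem : α → ℕ → ℕ → ℕ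
  bd : α → ℕ
  ok : α → Prop

variable {α : Type}

/-- The state `s` represents `a`, the variable `f` being held in register `pos f`. -/
def Ctx.At (Γ : Ctx α) (pos : (α → ℕ) → ℕ) (s : State) (a : α) : Prop :=
  Γ.ok a ∧ s.mem = Γ.mem a ∧ ∀ f ∈ Γ.vars, s.reg (pos f) = f a

/-- Started in `s`, the program `p` halts within `T` steps with `v` in register `d`, and changes
neither the memory nor the registers below `d`. -/
def Yields (p : Prog) (s : State) (T d v : ℕ) : Prop :=
  ∃ t s', Exec p s t s' ∧ t ≤ T ∧ s'.mem = s.mem ∧ (∀ i < d, s'.reg i = s.reg i) ∧ s'.reg d = v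

/-- The function `f` is computable in the context `Γ`, in time polynomial in the scale. -/
def Cmp (Γ : Ctx α) (f : α → ℕ) : Prop :=
  ∀ (pos : (α → ℕ) → ℕ) (d : ℕ), (∀ g ∈ Γ.vars, pos g < d) →
    ∃ p c, ∀ a s, Γ.At pos s a → Yields p s ((Γ.bd a + 2) ^ c) d (f a)

/-- The context with the additional variable `f`. -/
def Ctx.push (Γ : Ctx α) (f : α → ℕ) : Ctx α := { Γ with vars := insert f Γ.vars }

/-- The context of the body of a loop: there is an additional variable running below `b`. -/
def Ctx.ext (Γ : Ctx α) (b : α → ℕ) : Ctx (α × ℕ) where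
  vars := insert Prod.snd {g | ∃ f ∈ Γ.vars, g = fun x => f x.1}
  mem x := Γ.mem x.1
  bd x := Γ.bd x.1
  ok x := Γ.ok x.1 ∧ x.2 < b x.1

theorem State.setReg_reg_self (s : State) (i x : ℕ) : (s.setReg i x).reg i = x := by
  simp [State.setReg]

theorem State.setReg_reg_ne (s : State) {i j : ℕ} (x : ℕ) (h : j ≠ i) :
    (s.setReg i x).reg j = s.reg j := by
  simp [State.setReg, h]

theorem Yields.assign {s : State} {d v T : ℕ} (e : Expr) (h : e.eval s = v) (hT : e.cost + 1 ≤ T) :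
    Yields (.assign d e) s T d v :=
  ⟨_, _, .assign s d e, hT, rfl, fun _ hi => State.setReg_reg_ne _ _ hi.ne,
    by rw [State.setReg_reg_self, h]⟩

/-- This absorbs the sum of two running times into one power; it is why the base of the time bounds
is the scale plus `2`. -/
theorem pow_add_pow_le {X : ℕ} (hX : 2 ≤ X) (a b : ℕ) : X ^ a + X ^ b ≤ X ^ (a + b + 1) := by
  have ha : X ^ a ≤ X ^ (a + b) := Nat.pow_le_pow_right (by omega) (by omega)
  have hb : X ^ b ≤ X ^ (a + b) := Nat.pow_le_pow_right (by omega) (by omega)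
  calc X ^ a + X ^ b ≤ X ^ (a + b) * 2 := by omega
    _ ≤ X ^ (a + b) * X := Nat.mul_le_mul_left _ hX
    _ = X ^ (a + b + 1) := (pow_succ _ _).symm

theorem le_add_two_pow (B : ℕ) {m c : ℕ} (h : m ≤ 2 ^ c) : m ≤ (B + 2) ^ c :=
  h.trans (Nat.pow_le_pow_left (by omega) c)

theorem Cmp.congr {Γ : Ctx α} {f g : α → ℕ} (hf : Cmp Γ f) (h : ∀ a, Γ.ok a → f a = g a) :
    Cmp Γ g := by
  intro pos d hd
  obtain ⟨p, c, hp⟩ := hf pos d hd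
  exact ⟨p, c, fun a s hs => h a hs.1 ▸ hp a s hs⟩

theorem Cmp.lit (Γ : Ctx α) (m : ℕ) : Cmp Γ fun _ => m := fun _ _ _ =>
  ⟨.assign _ (.lit m), 1, fun _ _ _ => .assign _ rfl (le_add_two_pow _ (by simp [Expr.cost]))⟩

theorem Cmp.var {Γ : Ctx α} {f : α → ℕ} (h : f ∈ Γ.vars) : Cmp Γ f := fun pos _ _ =>
  ⟨.assign _ (.reg (pos f)), 1, fun _ _ hs =>
    .assign _ (hs.2.2 f h) (le_add_two_pow _ (by simp [Expr.cost]))⟩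

theorem Cmp.push {Γ : Ctx α} {g : α → ℕ} (hg : Cmp Γ g) (f : α → ℕ) : Cmp (Γ.push f) g := by
  intro pos d hd
  obtain ⟨p, c, hp⟩ := hg pos d fun g' hg' => hd g' (Set.mem_insert_of_mem _ hg')
  exact ⟨p, c, fun a s hs => hp a s ⟨hs.1, hs.2.1,
    fun g' hg' => hs.2.2 g' (Set.mem_insert_of_mem _ hg')⟩⟩

theorem Cmp.var_push (Γ : Ctx α) (f : α → ℕ) : Cmp (Γ.push f) f := .var (Set.mem_insert _ _)

open Classical in
/-- Intermediate results may be stored in a variable. -/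
theorem Cmp.letIn {Γ : Ctx α} {f g : α → ℕ} (hf : Cmp Γ f) (hg : Cmp (Γ.push f) g) : Cmp Γ g := by
  intro pos d hd
  obtain ⟨p, c, hp⟩ := hf pos d hd
  -- If `f` already is a variable, its register is merely redirected to `d`, which holds the same
  -- value.
  obtain ⟨q, c', hq⟩ := hg (Function.update pos f d) (d + 1) (by
    rintro g' (rfl | hg')
    · simp
    · by_cases h : g' = f
      · simp [h]
      · rw [Function.update_of_ne h]; exact (hd _ hg').trans (Nat.lt_succ_self d))
  refine ⟨.seq (.seq p q) (.assign d (.reg (d + 1))), c + c' + 1 + 1 + 1, fun a s hs => ?_⟩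
  obtain ⟨t, s₁, h₁, ht, hm, hr, hv⟩ := hp a s hs
  obtain ⟨t', s₂, h₂, ht', hm', hr', hv'⟩ := hq a s₁ ⟨hs.1, hm.trans hs.2.1, by
    rintro g' (rfl | hg')
    · simpa using hv
    · by_cases h : g' = f
      · subst h; simpa using hv
      · rw [Function.update_of_ne h, hr _ (hd _ hg')]; exact hs.2.2 _ hg'⟩
  refine ⟨_, _, .seq (.seq h₁ h₂) (.assign _ _ _), ?_, ?_, fun i hi => ?_, ?_⟩
  · have hX : 2 ≤ Γ.bd a + 2 := by omega
    have h3 := pow_add_pow_le hX c c'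
    have h4 := pow_add_pow_le hX (c + c' + 1) 1
    have h5 : (Γ.bd a + 2) ^ (c + c' + 1 + 1 + 1) = (Γ.bd a + 2) ^ (c + c' + 1 + 1) * (Γ.bd a + 2) :=
      pow_succ _ _
    have h6 : (Γ.bd a + 2) ^ (c + c' + 1 + 1) = (Γ.bd a + 2) ^ (c + c' + 1) * (Γ.bd a + 2) :=
      pow_succ _ _
    have ht'' : t' ≤ (Γ.bd a + 2) ^ c' := ht'
    have h7 : 1 ≤ (Γ.bd a + 2) ^ (c + c' + 1) := Nat.one_le_pow _ _ (by omega)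
    simp only [Expr.cost]
    nlinarith
  · exact hm'.trans hm
  · rw [State.setReg_reg_ne _ _ hi.ne, hr' i (by omega), hr i hi]
  · rw [State.setReg_reg_self]; exact hv'

/-- Binary operations given by expressions. -/
theorem Cmp.binary {Γ : Ctx α} {f g : α → ℕ} (hf : Cmp Γ f) (hg : Cmp Γ g) (op : ℕ → ℕ → ℕ)
    (E : ℕ → ℕ → Expr) (hE : ∀ s i j, (E i j).eval s = op (s.reg i) (s.reg j))
    (hc : ∀ i j, (E i j).cost ≤ 3) : Cmp Γ fun a => op (f a) (g a) := by
  refine hf.letIn ((hg.push f).letIn fun pos d hd => ⟨.assign d (E (pos f) (pos g)), 2, ?_⟩)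
  intro a s hs
  refine .assign _ ?_ (le_add_two_pow _ (by have := hc (pos f) (pos g); omega))
  rw [hE, hs.2.2 f (Set.mem_insert_of_mem _ (Set.mem_insert _ _)), hs.2.2 g (Set.mem_insert _ _)]

theorem Cmp.add {Γ : Ctx α} {f g : α → ℕ} (hf : Cmp Γ f) (hg : Cmp Γ g) :
    Cmp Γ fun a => f a + g a :=
  hf.binary hg (· + ·) (fun i j => .add (.reg i) (.reg j)) (fun _ _ _ => rfl) fun _ _ => le_rfl

theorem Cmp.sub {Γ : Ctx α} {f g : α → ℕ} (hf : Cmp Γ f) (hg : Cmp Γ g) :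
    Cmp Γ fun a => f a - g a :=
  hf.binary hg (· - ·) (fun i j => .sub (.reg i) (.reg j)) (fun _ _ _ => rfl) fun _ _ => le_rfl

theorem Cmp.load {Γ : Ctx α} {f : α → ℕ} (hf : Cmp Γ f) (m : ℕ) :
    Cmp Γ fun a => Γ.mem a m (f a) := by
  refine hf.letIn fun pos d hd => ⟨.assign d (.load m (.reg (pos f))), 2, fun a s hs => ?_⟩
  refine .assign _ ?_ (le_add_two_pow _ (by simp [Expr.cost]))
  simp only [Expr.eval]
  rw [hs.2.2 f (Set.mem_insert _ _), hs.2.1]; rfl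

theorem Cmp.ite_ne_zero {Γ : Ctx α} {e f g : α → ℕ} (he : Cmp Γ e) (hf : Cmp Γ f) (hg : Cmp Γ g) :
    Cmp Γ fun a => if e a ≠ 0 then f a else g a := by
  refine he.letIn fun pos d hd => ?_
  obtain ⟨p, c, hp⟩ := hf.push e pos d hd
  obtain ⟨q, c', hq⟩ := hg.push e pos d hd
  refine ⟨.ite (.reg (pos e)) p q, c + c' + 2, fun a s hs => ?_⟩
  have hle : ∀ {m t}, m ≤ c + c' → t ≤ (Γ.bd a + 2) ^ m →
      Expr.cost (.reg (pos e)) + 1 + t ≤ (Γ.bd a + 2) ^ (c + c' + 2) := by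
    intro m t hm ht
    have h1 := ht.trans (Nat.pow_le_pow_right (by omega : 0 < Γ.bd a + 2) hm)
    have h2 : 1 ≤ (Γ.bd a + 2) ^ (c + c') := Nat.one_le_pow _ _ (by omega)
    have h3 : 2 * 2 ≤ (Γ.bd a + 2) ^ 2 :=
      Nat.pow_le_pow_left (by omega : 2 ≤ Γ.bd a + 2) 2
    have h4 := Nat.mul_le_mul_left ((Γ.bd a + 2) ^ (c + c')) h3
    rw [pow_add]
    simp only [Expr.cost]
    omega
  have hev : (Expr.reg (pos e)).eval s = e a := hs.2.2 e (Set.mem_insert _ _)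
  by_cases h : e a = 0
  · obtain ⟨t, s', h₁, ht, hr⟩ := hq a s hs
    rw [if_neg (by simpa using h)]
    exact ⟨_, s', .iteFalse (hev.trans h) h₁, hle (Nat.le_add_left _ _) ht, hr⟩
  · obtain ⟨t, s', h₁, ht, hr⟩ := hp a s hs
    rw [if_pos h]
    exact ⟨_, s', .iteTrue (hev.trans_ne h) h₁, hle (Nat.le_add_right _ _) ht, hr⟩

/-- `r` is the number of rounds left. Each test of the loop condition costs four units. -/
theorem exec_countedLoop {body : Prog} {b d T : ℕ} (Inv : ℕ → State → Prop)
    (hbody : ∀ i s, i < b → Inv i s → ∃ t s', Exec body s t s' ∧ t ≤ T ∧ Inv (i + 1) s')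
    (hInv : ∀ i s, Inv i s → s.reg d = b ∧ s.reg (d + 1) = i) (r i : ℕ) (hi : i + r = b)
    (s : State) (hs : Inv i s) :
    ∃ t s', Exec (.loop (.sub (.reg d) (.reg (d + 1))) body) s t s' ∧ t ≤ r * (T + 4) + 4 ∧
      Inv b s' := by
  induction r generalizing i s with
  | zero =>
    have h := hInv i s hs
    exact ⟨_, s, .loopDone (by simp only [Expr.eval]; omega), by simp [Expr.cost],
      by rwa [← hi]⟩
  | succ r ih =>
    have h := hInv i s hs
    obtain ⟨t, s₁, h₁, ht, hs₁⟩ := hbody i s (by omega) hs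
    obtain ⟨t', s₂, h₂, ht', hs₂⟩ := ih (i + 1) (by omega) s₁ hs₁
    refine ⟨_, s₂, .loopStep (by simp only [Expr.eval]; omega) h₁ h₂, ?_, hs₂⟩
    rw [Nat.succ_mul]
    simp only [Expr.cost]
    omega

open Classical in
/-- Iteration: a sequence is computable if each term is computed from the preceding one. -/
theorem Cmp.iterate {Γ : Ctx α} {b : α → ℕ} (F : α → ℕ → ℕ) (hb : Cmp Γ b)
    (h0 : Cmp Γ fun a => F a 0)
    (hs : Cmp ((Γ.ext b).push fun x => F x.1 x.2) fun x => F x.1 (x.2 + 1))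
    (hB : ∀ a, Γ.ok a → b a ≤ Γ.bd a) : Cmp Γ fun a => F a (b a) := by
  intro pos d hd
  obtain ⟨p, c, hp⟩ := h0 pos d hd
  obtain ⟨q, c', hq⟩ := hb pos (d + 1) fun g hg => (hd g hg).trans (Nat.lt_succ_self d)
  -- Register `d` holds the current term, `d + 1` the number of rounds, `d + 2` the counter; the
  -- body leaves the next term in `d + 3`. Coinciding variables cause no conflict, since any
  -- register chosen holds the right value.
  let pos' : (α × ℕ → ℕ) → ℕ := fun g =>
    if g = Prod.snd then d + 2 else if g = fun x => F x.1 x.2 then d else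
      if h : ∃ f ∈ Γ.vars, g = fun x => f x.1 then pos h.choose else 0
  have hpos' : ∀ g ∈ ((Γ.ext b).push fun x => F x.1 x.2).vars, pos' g < d + 3 := by
    intro g _
    simp only [pos']
    split_ifs with h1 h2 h3
    · omega
    · omega
    · have := hd _ h3.choose_spec.1; omega
    · omega
  obtain ⟨w, e, hw⟩ := hs pos' (d + 3) hpos'
  let body : Prog := .seq w (.seq (.assign d (.reg (d + 3)))
    (.assign (d + 2) (.add (.reg (d + 2)) (.lit 1))))
  refine ⟨.seq p (.seq q (.seq (.assign (d + 2) (.lit 0))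
    (.loop (.sub (.reg (d + 1)) (.reg (d + 2))) body))), c + c' + e + 6, fun a s hs => ?_⟩
  obtain ⟨t, s₁, h₁, ht, hm, hr, hv⟩ := hp a s hs
  obtain ⟨t', s₂, h₂, ht', hm', hr', hv'⟩ := hq a s₁ ⟨hs.1, hm.trans hs.2.1, fun g hg => by
    rw [hr _ (hd _ hg)]; exact hs.2.2 g hg⟩
  let Inv : ℕ → State → Prop := fun i s' => s'.mem = s.mem ∧ (∀ j < d, s'.reg j = s.reg j) ∧
    s'.reg d = F a i ∧ s'.reg (d + 1) = b a ∧ s'.reg (d + 2) = i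
  -- The `6` pays for copying the new term (`2`) and incrementing the counter (`4`).
  have hbody : ∀ i s', i < b a → Inv i s' → ∃ t s'', Exec body s' t s'' ∧
      t ≤ (Γ.bd a + 2) ^ e + 6 ∧ Inv (i + 1) s'' := by
    rintro i s' hi ⟨im, ir, iF, ib, ii⟩
    obtain ⟨u, s₃, h₃, hu, um, ur, uv⟩ := hw (a, i) s' ⟨⟨hs.1, hi⟩, im.trans hs.2.1, by
      intro g hg
      simp only [pos']
      split_ifs with h1 h2 h3
      · rw [h1]; exact ii
      · rw [h2]; exact iF
      · have h4 := h3.choose_spec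
        rw [ir _ (hd _ h4.1), hs.2.2 _ h4.1]
        exact (congrFun h4.2 (a, i)).symm
      · rcases hg with hg | hg | hg
        · exact absurd hg h2
        · exact absurd hg h1
        · exact absurd hg h3⟩
    refine ⟨_, _, .seq h₃ (.seq (.assign _ _ _) (.assign _ _ _)), ?_, um.trans im, ?_, ?_, ?_, ?_⟩
    · have hu' : u ≤ (Γ.bd a + 2) ^ e := hu
      simp only [Expr.cost]; omega
    · intro j hj
      rw [State.setReg_reg_ne _ _ (by omega), State.setReg_reg_ne _ _ (by omega), ur _ (by omega),
        ir _ hj]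
    · rw [State.setReg_reg_ne _ _ (by omega), State.setReg_reg_self]
      exact uv
    · rw [State.setReg_reg_ne _ _ (by omega), State.setReg_reg_ne _ _ (by omega), ur _ (by omega), ib]
    · rw [State.setReg_reg_self]
      simp only [Expr.eval]
      rw [State.setReg_reg_ne _ _ (by omega), ur _ (by omega), ii]
  obtain ⟨t₄, s₄, h₄, ht₄, hm₄, hr₄, hF₄, -, -⟩ := exec_countedLoop Inv hbody
    (fun i s' h => ⟨h.2.2.2.1, h.2.2.2.2⟩) (b a) 0 (zero_add _) (s₂.setReg (d + 2) 0)
    ⟨hm'.trans hm, fun j hj => by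
        rw [State.setReg_reg_ne _ _ (by omega), hr' _ (by omega), hr _ hj], by
        rw [State.setReg_reg_ne _ _ (by omega), hr' _ (by omega), hv], by
        rw [State.setReg_reg_ne _ _ (by omega), hv'], State.setReg_reg_self _ _ _⟩
  refine ⟨_, s₄, .seq h₁ (.seq h₂ (.seq (.assign _ _ _) h₄)), ?_, hm₄, hr₄, hF₄⟩
  have hbB := hB a hs.1
  clear_value Inv body pos'
  clear hbody hF₄ hr₄ hm₄ h₄ hv' hr' hm' h₂ hv hr hm h₁ hs hw hpos' hq hp hB
  generalize hX : Γ.bd a = B at *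
  have hX2 : 1 ≤ B + 2 := by omega
  have k1 := ht.trans (Nat.pow_le_pow_right hX2 (by omega : c ≤ c + c' + e))
  have k2 := ht'.trans (Nat.pow_le_pow_right hX2 (by omega : c' ≤ c + c' + e))
  have k3 := Nat.pow_le_pow_right hX2 (by omega : e ≤ c + c' + e)
  have k4 : 1 ≤ (B + 2) ^ (c + c' + e) := Nat.one_le_pow _ _ hX2
  generalize (B + 2) ^ e = Z at *
  rw [pow_add]
  generalize (B + 2) ^ (c + c' + e) = Y at *
  have k5 : b a * (Z + 6 + 4) ≤ B * (Y + 10) := Nat.mul_le_mul hbB (by omega)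
  have k6 : 2 ^ 5 * (B + 2) ≤ (B + 2) ^ 6 := by
    rw [pow_succ (B + 2) 5]
    exact Nat.mul_le_mul_right _ (Nat.pow_le_pow_left (by omega) 5)
  have k7 := Nat.mul_le_mul_left Y k6
  simp only [Expr.cost]
  nlinarith

end RAM

/-! ### Decidable predicates, bounded quantifiers, search and arithmetic. -/

namespace RAM

variable {α : Type}

-- The same program works in both contexts, once each variable `g` of `Γ` is read from the register
-- that `Δ` assigns to `g ∘ h`.
open Classical in
theorem Cmp.reindex {β : Type} {Γ : Ctx α} {Δ : Ctx β} {f : α → ℕ} (hf : Cmp Γ f) (h : β → α)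
    (hvars : ∀ g ∈ Γ.vars, (fun b => g (h b)) ∈ Δ.vars) (hmem : ∀ b, Δ.mem b = Γ.mem (h b))
    (hbd : ∀ b, Δ.bd b = Γ.bd (h b)) (hok : ∀ b, Δ.ok b → Γ.ok (h b)) :
    Cmp Δ fun b => f (h b) := by
  intro pos d hd
  obtain ⟨p, c, hp⟩ := hf (fun g => if g ∈ Γ.vars then pos fun b => g (h b) else 0) d (by
    intro g hg
    simp only [hg, if_true]
    exact hd _ (hvars g hg))
  refine ⟨p, c, fun b s hs => hbd b ▸ hp (h b) s ⟨hok b hs.1, hs.2.1.trans (hmem b), fun g hg => ?_⟩⟩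
  simp only [hg, if_true]
  exact hs.2.2 _ (hvars g hg)

theorem Cmp.lift {Γ : Ctx α} {f : α → ℕ} (hf : Cmp Γ f) (b : α → ℕ) :
    Cmp (Γ.ext b) fun x => f x.1 :=
  hf.reindex Prod.fst (fun g hg => Set.mem_insert_of_mem _ ⟨g, hg, rfl⟩) (fun _ => rfl)
    (fun _ => rfl) fun _ h => h.1

/-- A function of a loop variable may be used in a further loop. -/
theorem Cmp.lift_inner {Γ : Ctx α} {b b' : α → ℕ} {b'' : α × ℕ → ℕ} {f : α → ℕ → ℕ}
    (hf : Cmp (Γ.ext b) fun x => f x.1 x.2) (hb : ∀ x, b'' x ≤ b x.1) :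
    Cmp ((Γ.ext b').ext b'') fun x => f x.1.1 x.2 :=
  hf.reindex (fun x : (α × ℕ) × ℕ => (x.1.1, x.2))
    (by
      rintro g (rfl | ⟨f, hf, rfl⟩)
      · exact Set.mem_insert _ _
      · exact Set.mem_insert_of_mem _ ⟨_, Set.mem_insert_of_mem _ ⟨f, hf, rfl⟩, rfl⟩)
    (fun _ => rfl) (fun _ => rfl) fun x h => ⟨h.1.1, h.2.trans_le (hb x.1)⟩

theorem Cmp.index (Γ : Ctx α) (b : α → ℕ) : Cmp (Γ.ext b) fun x => x.2 :=
  .var (Set.mem_insert _ _)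

open Classical in
/-- The predicate `p` is decidable in the context `Γ`, in time polynomial in the scale. -/
def Dec (Γ : Ctx α) (p : α → Prop) : Prop := Cmp Γ fun a => if p a then 1 else 0

theorem Dec.push {Γ : Ctx α} {p : α → Prop} (hp : Dec Γ p) (f : α → ℕ) : Dec (Γ.push f) p :=
  Cmp.push hp f

theorem Dec.lift {Γ : Ctx α} {p : α → Prop} (hp : Dec Γ p) (b : α → ℕ) :
    Dec (Γ.ext b) fun x => p x.1 := Cmp.lift hp b

theorem Dec.congr {Γ : Ctx α} {p q : α → Prop} (hp : Dec Γ p) (h : ∀ a, Γ.ok a → (p a ↔ q a)) :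
    Dec Γ q := Cmp.congr hp fun a ha => by
    by_cases hq : q a
    · rw [if_pos hq, if_pos ((h a ha).2 hq)]
    · rw [if_neg hq, if_neg (mt (h a ha).1 hq)]

open Classical in
theorem Cmp.ite {Γ : Ctx α} {p : α → Prop} {f g : α → ℕ} (hp : Dec Γ p) (hf : Cmp Γ f)
    (hg : Cmp Γ g) : Cmp Γ fun a => if p a then f a else g a :=
  (Cmp.ite_ne_zero hp hf hg).congr fun a _ => by by_cases h : p a <;> simp [h]

theorem Dec.ne_zero {Γ : Ctx α} {f : α → ℕ} (hf : Cmp Γ f) : Dec Γ fun a => f a ≠ 0 :=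
  (hf.ite_ne_zero (.lit Γ 1) (.lit Γ 0)).congr fun a _ => by by_cases h : f a = 0 <;> simp [h]

theorem Dec.lt {Γ : Ctx α} {f g : α → ℕ} (hf : Cmp Γ f) (hg : Cmp Γ g) :
    Dec Γ fun a => f a < g a :=
  (Dec.ne_zero (hg.sub hf)).congr fun _ _ => by omega

theorem Dec.not {Γ : Ctx α} {p : α → Prop} (hp : Dec Γ p) : Dec Γ fun a => ¬ p a :=
  (Cmp.ite hp (.lit Γ 0) (.lit Γ 1)).congr fun a _ => by by_cases h : p a <;> simp [h]

theorem Dec.and {Γ : Ctx α} {p q : α → Prop} (hp : Dec Γ p) (hq : Dec Γ q) :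
    Dec Γ fun a => p a ∧ q a :=
  (Cmp.ite hp hq (.lit Γ 0)).congr fun a _ => by
    by_cases h : p a <;> by_cases h' : q a <;> simp [h, h']

theorem Dec.imp {Γ : Ctx α} {p q : α → Prop} (hp : Dec Γ p) (hq : Dec Γ q) :
    Dec Γ fun a => p a → q a :=
  (hp.and hq.not).not.congr fun a _ => by tauto

theorem Dec.le {Γ : Ctx α} {f g : α → ℕ} (hf : Cmp Γ f) (hg : Cmp Γ g) :
    Dec Γ fun a => f a ≤ g a :=
  (Dec.lt hg hf).not.congr fun _ _ => by omega

theorem Dec.eq {Γ : Ctx α} {f g : α → ℕ} (hf : Cmp Γ f) (hg : Cmp Γ g) :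
    Dec Γ fun a => f a = g a :=
  ((Dec.le hf hg).and (Dec.le hg hf)).congr fun _ _ => by omega

/-- The iterated value is the truth value of the statement for the indices below `j`. -/
theorem Dec.all {Γ : Ctx α} {b : α → ℕ} {p : α → ℕ → Prop} (hb : Cmp Γ b)
    (hp : Dec (Γ.ext b) fun x => p x.1 x.2) (hB : ∀ a, Γ.ok a → b a ≤ Γ.bd a) :
    Dec Γ fun a => ∀ i < b a, p a i := by
  refine Cmp.iterate (fun a j => @_root_.ite ℕ (∀ i < j, p a i) (Classical.propDecidable _) 1 0) hb
    ((Cmp.lit Γ 1).congr fun a _ => by simp) ?_ hB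
  refine (Cmp.ite (hp.push _) (.var_push _ _) (.lit _ 0)).congr fun x _ => ?_
  have h1 := Nat.forall_lt_succ_right (n := x.2) (p := p x.1)
  by_cases h : p x.1 x.2 <;> by_cases h2 : ∀ i < x.2, p x.1 i
  · rw [if_pos h, if_pos h2, if_pos (h1.2 ⟨h2, h⟩)]
  · rw [if_pos h, if_neg h2, if_neg fun h3 => h2 (h1.1 h3).1]
  · rw [if_neg h, if_neg fun h3 => h (h1.1 h3).2]
  · rw [if_neg h, if_neg fun h3 => h (h1.1 h3).2]

theorem Dec.exists {Γ : Ctx α} {b : α → ℕ} {p : α → ℕ → Prop} (hb : Cmp Γ b)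
    (hp : Dec (Γ.ext b) fun x => p x.1 x.2) (hB : ∀ a, Γ.ok a → b a ≤ Γ.bd a) :
    Dec Γ fun a => ∃ i < b a, p a i :=
  (Dec.all (p := fun a i => ¬ p a i) hb hp.not hB).not.congr fun _ _ => by simp

/-- The least `i < b` with `p i`, and `b` if there is none. -/
noncomputable def search (p : ℕ → Prop) : ℕ → ℕ
  | 0 => 0
  | b + 1 => open Classical in if search p b < b then search p b else if p b then b else b + 1

theorem search_le (p : ℕ → Prop) (b : ℕ) : search p b ≤ b := by
  induction b with
  | zero => exact le_rfl
  | succ b ih => simp only [search]; split_ifs <;> omega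

theorem search_spec {p : ℕ → Prop} {b : ℕ} (h : search p b < b) : p (search p b) := by
  induction b with
  | zero => omega
  | succ b ih =>
    simp only [search] at h ⊢
    split_ifs at h ⊢ with h1 h2
    · exact ih h1
    · exact h2
    · omega

theorem search_lt {p : ℕ → Prop} {b i : ℕ} (hi : i < b) (h : p i) : search p b < b := by
  induction b with
  | zero => omega
  | succ b ih =>
    simp only [search]
    split_ifs with h1 h2
    · omega
    · omega
    · rcases Nat.lt_succ_iff_lt_or_eq.1 hi with h3 | rfl
      · exact absurd (ih h3) h1
      · exact absurd h h2

theorem Cmp.search {Γ : Ctx α} {b : α → ℕ} {p : α → ℕ → Prop} (hb : Cmp Γ b)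
    (hp : Dec (Γ.ext b) fun x => p x.1 x.2) (hB : ∀ a, Γ.ok a → b a ≤ Γ.bd a) :
    Cmp Γ fun a => search (p a) (b a) := by
  have hi := (Cmp.index Γ b).push fun x => RAM.search (p x.1) x.2
  have hv := Cmp.var_push (Γ.ext b) fun x => RAM.search (p x.1) x.2
  exact Cmp.iterate (fun a j => RAM.search (p a) j) hb (Cmp.lit Γ 0)
    ((Cmp.ite (.lt hv hi) hv (.ite (hp.push _) hi (hi.add (.lit _ 1)))).congr fun x _ => by
      simp only [RAM.search]; congr) hB

open Classical in
theorem Cmp.count {Γ : Ctx α} {b : α → ℕ} {p : α → ℕ → Prop} (hb : Cmp Γ b)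
    (hp : Dec (Γ.ext b) fun x => p x.1 x.2) (hB : ∀ a, Γ.ok a → b a ≤ Γ.bd a) :
    Cmp Γ fun a => Nat.count (p a) (b a) :=
  Cmp.iterate (fun a j => Nat.count (p a) j) hb ((Cmp.lit Γ 0).congr fun _ _ => by simp)
    (((Cmp.var_push _ _).add (Cmp.push hp _)).congr fun _ _ => (Nat.count_succ _ _).symm) hB

/-- Repeated addition: only the number of rounds `g` must be below the scale, not the product. For
powers both arguments are bounded, since every round multiplies by `f`. -/
theorem Cmp.mul {Γ : Ctx α} {f g : α → ℕ} (hf : Cmp Γ f) (hg : Cmp Γ g)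
    (hB : ∀ a, Γ.ok a → g a ≤ Γ.bd a) : Cmp Γ fun a => f a * g a :=
  Cmp.iterate (fun a j => f a * j) hg (.lit Γ 0)
    (((Cmp.var_push _ _).add ((hf.lift _).push _)).congr fun _ _ => (Nat.mul_succ _ _).symm) hB

theorem Cmp.pow {Γ : Ctx α} {f g : α → ℕ} (hf : Cmp Γ f) (hg : Cmp Γ g)
    (hfB : ∀ a, Γ.ok a → f a ≤ Γ.bd a) (hB : ∀ a, Γ.ok a → g a ≤ Γ.bd a) :
    Cmp Γ fun a => f a ^ g a :=
  Cmp.iterate (fun a j => f a ^ j) hg ((Cmp.lit Γ 1).congr fun _ _ => (pow_zero _).symm)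
    (((Cmp.var_push _ _).mul ((hf.lift _).push _) fun x hx => hfB x.1 hx.1).congr
      fun _ _ => (pow_succ _ _).symm) hB

/-- These recurrences maintain quotient and remainder while counting up to the dividend; they also
hold for `m = 0`. -/
theorem succ_div_mod_eq_ite (i m : ℕ) :
    (i + 1) / m = (if i % m + 1 = m then i / m + 1 else i / m) ∧
      (i + 1) % m = (if i % m + 1 = m then 0 else i % m + 1) := by
  rcases Nat.eq_zero_or_pos m with rfl | hm
  · simp
  · have h1 := Nat.div_add_mod i m
    have h2 := Nat.mod_lt i hm
    split_ifs with h
    · refine (Nat.div_mod_unique hm).2 ⟨?_, hm⟩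
      rw [Nat.mul_succ]; omega
    · refine (Nat.div_mod_unique hm).2 ⟨?_, ?_⟩ <;> omega

theorem Cmp.mod {Γ : Ctx α} {f g : α → ℕ} (hf : Cmp Γ f) (hg : Cmp Γ g)
    (hB : ∀ a, Γ.ok a → f a ≤ Γ.bd a) : Cmp Γ fun a => f a % g a := by
  have h1 := (Cmp.var_push (Γ.ext f) fun x => x.2 % g x.1).add (.lit _ 1)
  exact Cmp.iterate (fun a j => j % g a) hf ((Cmp.lit Γ 0).congr fun _ _ => (Nat.zero_mod _).symm)
    ((Cmp.ite (.eq h1 ((hg.lift _).push _)) (.lit _ 0) h1).congr fun x _ => by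
      rw [(succ_div_mod_eq_ite _ _).2]; congr) hB

theorem Cmp.div {Γ : Ctx α} {f g : α → ℕ} (hf : Cmp Γ f) (hg : Cmp Γ g)
    (hB : ∀ a, Γ.ok a → f a ≤ Γ.bd a) : Cmp Γ fun a => f a / g a := by
  have h1 := ((Cmp.index Γ f).mod (hg.lift _) fun x hx => hx.2.le.trans (hB x.1 hx.1)).add (.lit _ 1)
  have h2 := Cmp.var_push (Γ.ext f) fun x => x.2 / g x.1
  exact Cmp.iterate (fun a j => j / g a) hf ((Cmp.lit Γ 0).congr fun _ _ => (Nat.zero_div _).symm)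
    ((Cmp.ite (.eq (h1.push _) ((hg.lift _).push _)) (h2.add (.lit _ 1)) h2).congr
      fun x _ => by rw [(succ_div_mod_eq_ite _ _).1]; congr) hB

theorem Cmp.digit {N m i : α → ℕ} (hN : Cmp Γ N) (hm : Cmp Γ m) (hi : Cmp Γ i)
    (hNB : ∀ a, Γ.ok a → N a ≤ Γ.bd a) (hmB : ∀ a, Γ.ok a → m a ≤ Γ.bd a)
    (hiB : ∀ a, Γ.ok a → i a ≤ Γ.bd a) : Cmp Γ fun a => N a / m a ^ i a % m a :=
  (hN.div (hm.pow hi hmB hiB) hNB).mod hm fun a ha => (Nat.div_le_self _ _).trans (hNB a ha)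

end RAM

/-! ### Vertex sets containing no support of an automorphism -/

namespace ColoredGraph

variable {V γ : Type*} {G : SimpleGraph V} {c : V → γ}

/-- No nontrivial automorphism moves only vertices in `K`. -/
def IsFree (G : SimpleGraph V) (c : V → γ) (K : Finset V) : Prop :=
  ∀ π : Equiv.Perm V, IsAut G c π → (∀ v ∉ K, π v = v) → π = 1

theorem IsAut.mul {π σ : Equiv.Perm V} (hπ : IsAut G c π) (hσ : IsAut G c σ) :
    IsAut G c (π * σ) :=
  ⟨fun _ _ => (hπ.1 _ _).trans (hσ.1 _ _), fun _ => (hπ.2 _).trans (hσ.2 _)⟩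

theorem IsAut.inv {π : Equiv.Perm V} (hπ : IsAut G c π) : IsAut G c π⁻¹ :=
  ⟨fun u v => by simpa using (hπ.1 (π⁻¹ u) (π⁻¹ v)).symm,
    fun v => by simpa using (hπ.2 (π⁻¹ v)).symm⟩

theorem isAut_swap [DecidableEq V] {u v : V} (hc : c u = c v)
    (h : ∀ x, x ≠ u → x ≠ v → (G.Adj x u ↔ G.Adj x v)) : IsAut G c (Equiv.swap u v) := by
  constructor
  · intro x y
    have h' : ∀ x, x ≠ u → x ≠ v → (G.Adj u x ↔ G.Adj v x) := fun x hu hv => by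
      simpa only [G.adj_comm] using h x hu hv
    simp only [Equiv.swap_apply_def]
    split_ifs <;> subst_vars <;> simp_all [G.adj_comm]
    rw [← h' _ ‹_› ‹_›, G.adj_comm]
  · intro x
    simp only [Equiv.swap_apply_def]
    split_ifs <;> subst_vars <;> simp [hc]

theorem nSubKRigid_iff [Fintype V] {k : ℕ} :
    NSubKRigid G c k ↔ ∃ K : Finset V, K.card = k ∧ IsFree G c K := by
  classical
  constructor
  · rintro ⟨S, hS, h⟩
    exact ⟨Sᶜ, by rw [Finset.card_compl]; omega,
      fun π hπ hv => h π hπ fun v hvS => hv v (by simpa using hvS)⟩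
  · rintro ⟨K, hK, h⟩
    exact ⟨Kᶜ, by rw [Finset.card_compl]; have := K.card_le_univ; omega,
      fun π hπ hv => h π hπ fun v hvS => hv v (by simpa using hvS)⟩

theorem IsFree.map {K : Finset V} (hK : IsFree G c K) {g : Equiv.Perm V} (hg : IsAut G c g) :
    IsFree G c (K.map g.toEmbedding) := by
  intro π hπ h
  have h1 : g⁻¹ * π * g = 1 := by
    refine hK _ ((hg.inv.mul hπ).mul hg) fun v hv => ?_
    have : π (g v) = g v := h _ (by simpa using hv)
    simp [this]
  calc π = g * (g⁻¹ * π * g) * g⁻¹ := by group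
    _ = 1 := by rw [h1]; group

theorem IsFree.eq_of_isAut_swap [DecidableEq V] {K : Finset V} (hK : IsFree G c K) {u v : V}
    (hu : u ∈ K) (hv : v ∈ K) (h : IsAut G c (Equiv.swap u v)) : u = v := by
  refine Equiv.swap_eq_one_iff.1 (hK _ h fun w hw => Equiv.swap_apply_of_ne_of_ne ?_ ?_)
  · rintro rfl; exact hw hu
  · rintro rfl; exact hw hv

theorem isFree_empty : IsFree G c ∅ := fun _ _ h => Equiv.ext fun v => h v (by simp)

/-- Among the free sets of a given size there is one consisting of vertices that cannot be swapped
with a smaller one. -/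
theorem exists_isFree_forall_not_isAut_swap {n : ℕ} {G : SimpleGraph (Fin n)} {c : Fin n → γ}
    {K : Finset (Fin n)} (hK : IsFree G c K) :
    ∃ K' : Finset (Fin n), K'.card = K.card ∧ IsFree G c K' ∧
      ∀ v ∈ K', ∀ u < v, ¬ IsAut G c (Equiv.swap u v) := by
  induction hm : ∑ v ∈ K, v.val using Nat.strong_induction_on generalizing K with
  | _ m ih =>
  by_cases h : ∀ v ∈ K, ∀ u < v, ¬ IsAut G c (Equiv.swap u v)
  · exact ⟨K, rfl, hK, h⟩
  push Not at h
  obtain ⟨v, hv, u, huv, hs⟩ := h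
  have hu : u ∉ K := fun hu => huv.ne (hK.eq_of_isAut_swap hu hv hs)
  have hlt : ∑ w ∈ K.map (Equiv.swap u v).toEmbedding, w.val < m := by
    rw [← hm, Finset.sum_map]
    refine Finset.sum_lt_sum (fun w hw => ?_) ⟨v, hv, by simpa using huv⟩
    simp only [Equiv.coe_toEmbedding, Equiv.swap_apply_def]
    split_ifs with h1 h2
    · subst h1; exact absurd hw hu
    · subst h2; exact huv.le
    · exact le_rfl
  obtain ⟨K', h1, h2⟩ := ih _ hlt (hK.map hs) rfl
  exact ⟨K', by simpa using h1, h2⟩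

/-- Two automorphisms with supports `K ∪ {b}` and `K ∪ {b'}` acting in the same way on `K` yield an
automorphism that is a `3`-cycle, and so the vertices `b` and `b'` are twins. -/
theorem isAut_swap_of_agree [DecidableEq V] {K : Finset V} {b b' : V} (hb : b ∉ K) (hb' : b' ∉ K)
    (hbb : b ≠ b') {π σ : Equiv.Perm V} (hπ : IsAut G c π) (hσ : IsAut G c σ)
    (hπK : ∀ v, v ∉ K → v ≠ b → π v = v) (hσK : ∀ v, v ∉ K → v ≠ b' → σ v = v)
    (hπb : π b ≠ b) (hσb : σ b' ≠ b')
    (h : ∀ a ∈ K, (π a ∈ K ↔ σ a ∈ K) ∧ (π a ∈ K → π a = σ a)) :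
    IsAut G c (Equiv.swap b b') := by
  -- A value outside `K` other than `b` is itself a fixed point, so by injectivity its argument is
  -- too.
  have key : ∀ {π : Equiv.Perm V} {b : V}, (∀ v, v ∉ K → v ≠ b → π v = v) →
      ∀ v, π v ∉ K → π v = b ∨ π v = v := by
    intro π b hK v hv
    by_cases h1 : π v = b
    · exact .inl h1
    · exact .inr (π.injective (hK _ hv h1))
  obtain ⟨a, ha⟩ := π.surjective b
  have hab : a ≠ b := by rintro rfl; exact hπb ha
  have haK : a ∈ K := by
    by_contra h1
    exact hab ((hπK a h1 hab).symm.trans ha)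
  have hσa : σ a = b' := by
    have h1 : σ a ∉ K := fun h1 => hb (ha ▸ (h a haK).1.2 h1)
    rcases key hσK a h1 with h2 | h2
    · exact h2
    · rw [h2] at h1; exact absurd haK h1
  have hagree : ∀ x, x ≠ a → x ≠ b → x ≠ b' → π x = σ x := by
    intro x hxa hxb hxb'
    by_cases hx : x ∈ K
    · refine (h x hx).2 ?_
      by_contra h1
      rcases key hπK x h1 with h2 | h2
      · exact hxa (π.injective (h2.trans ha.symm))
      · rw [h2] at h1; exact h1 hx
    · rw [hπK x hx hxb, hσK x hx hxb']
  have hσb' : σ b' = π b := by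
    obtain ⟨x, hx⟩ := π.surjective (σ b')
    have h1 : x ≠ a := by
      rintro rfl
      have : σ b' ∉ K := by rw [← hx, ha]; exact hb
      have h3 := hσK _ this hσb
      exact hσb (σ.injective h3)
    have h2 : x ≠ b' := by
      rintro rfl
      rw [hπK x hb' hbb.symm] at hx
      exact hσb hx.symm
    by_contra h3
    have h4 : x ≠ b := by rintro rfl; exact h3 hx.symm
    exact h2 (σ.injective ((hagree x h1 h4 h2).symm.trans hx))
  -- This automorphism is the 3-cycle `a ↦ b' ↦ b ↦ a`, where `π a = b`.
  have hτ : IsAut G c (π⁻¹ * σ) := hπ.inv.mul hσ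
  have t1 : (π⁻¹ * σ) a = b' := by
    rw [Equiv.Perm.mul_apply, hσa, Equiv.Perm.inv_eq_iff_eq, hπK b' hb' hbb.symm]
  have t2 : (π⁻¹ * σ) b' = b := by simp [hσb']
  have t3 : (π⁻¹ * σ) b = a := by
    rw [Equiv.Perm.mul_apply, hσK b hb hbb, Equiv.Perm.inv_eq_iff_eq, ha]
  have t4 : ∀ x, x ≠ a → x ≠ b → x ≠ b' → (π⁻¹ * σ) x = x := by
    intro x h1 h2 h3
    simp [← hagree x h1 h2 h3]
  refine isAut_swap ?_ fun x hxb hxb' => ?_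
  · rw [← t2, hτ.2]
  -- The cycle sends the pair `(a, b)` to `(b', a)`; any other `x` is fixed, while `b'` goes to `b`.
  · by_cases hxa : x = a
    · subst hxa
      have := hτ.1 x b
      rw [t1, t3] at this
      rw [← this, G.adj_comm]
    · have := hτ.1 x b'
      rwa [t2, t4 x hxa hxb hxb'] at this

/-- Pigeonhole: a bad `b` is encoded by the action of its automorphism on `K`, with `none` for
points leaving `K`. There are `(|K| + 1) ^ |K|` codes, and equal codes would give twins in `T`. The
automorphism must move `b`, as otherwise freeness of `K` would make it trivial. -/
theorem exists_isFree_insert [DecidableEq V] {T K : Finset V} (hK : IsFree G c K)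
    (hT : ∀ u ∈ T, ∀ v ∈ T, IsAut G c (Equiv.swap u v) → u = v)
    (hcard : K.card + (K.card + 1) ^ K.card < T.card) :
    ∃ b ∈ T, b ∉ K ∧ IsFree G c (insert b K) := by
  by_contra! hcon
  have hex : ∀ b : ↥(T \ K), ∃ π : Equiv.Perm V, IsAut G c π ∧
      (∀ v, v ∉ K → v ≠ b.1 → π v = v) ∧ π b.1 ≠ b.1 := by
    intro b
    have hb := Finset.mem_sdiff.1 b.2
    have h1 := hcon b.1 hb.1 hb.2
    simp only [IsFree] at h1
    push Not at h1
    obtain ⟨π, hπ, hv, h1⟩ := h1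
    have hv' : ∀ v, v ∉ K → v ≠ b.1 → π v = v := fun v h2 h3 => hv v (by simp [h2, h3])
    refine ⟨π, hπ, hv', fun h2 => h1 (hK π hπ fun v hvK => ?_)⟩
    by_cases h3 : v = b.1
    · rw [h3, h2]
    · exact hv' v hvK h3
  choose π hπ hfix hmove using hex
  let code : ↥(T \ K) → (↥K → Option ↥K) := fun b a =>
    if h : π b a ∈ K then some ⟨π b a, h⟩ else none
  have hinj : Function.Injective code := by
    intro b b' hbb
    by_contra hne
    have hb := Finset.mem_sdiff.1 b.2
    have hb' := Finset.mem_sdiff.1 b'.2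
    have hne' : b.1 ≠ b'.1 := fun h => hne (Subtype.ext h)
    refine hne' (hT _ hb.1 _ hb'.1 (isAut_swap_of_agree hb.2 hb'.2 hne' (hπ b) (hπ b') (hfix b)
      (hfix b') (hmove b) (hmove b') fun a ha => ?_))
    have := congrFun hbb ⟨a, ha⟩
    simp only [code] at this
    split_ifs at this with h1 h2 h2
    · simp only [Option.some.injEq, Subtype.mk.injEq] at this
      exact ⟨iff_of_true h1 h2, fun _ => this⟩
    · exact ⟨iff_of_false h1 h2, fun h3 => absurd h3 h1⟩
  have := Fintype.card_le_of_injective code hinj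
  simp only [Fintype.card_coe, Fintype.card_fun, Fintype.card_option] at this
  have h2 := Finset.le_card_sdiff K T
  omega

/-- Greedy extension: for `j < k` one has `(j + 1) ^ j ≤ k ^ k`, so `T` has room for one more vertex
at each size `j`. -/
theorem exists_isFree_card_eq {T : Finset V}
    (hT : ∀ u ∈ T, ∀ v ∈ T, open Classical in IsAut G c (Equiv.swap u v) → u = v) {k : ℕ}
    (hcard : k ^ k + k ≤ T.card) : ∃ K ⊆ T, K.card = k ∧ IsFree G c K := by
  classical
  suffices ∀ j ≤ k, ∃ K ⊆ T, K.card = j ∧ IsFree G c K from this k le_rfl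
  intro j
  induction j with
  | zero => exact fun _ => ⟨∅, by simp, rfl, isFree_empty⟩
  | succ j ih =>
    intro hj
    obtain ⟨K, hKT, hKj, hK⟩ := ih (by omega)
    have h1 : (j + 1) ^ j ≤ k ^ k :=
      (Nat.pow_le_pow_left hj j).trans (Nat.pow_le_pow_right (by omega) (by omega))
    obtain ⟨b, hb, hbK, hfree⟩ := exists_isFree_insert (T := T) hK
      (fun u hu v hv h => hT u hu v hv (by convert h))
      (by rw [hKj]; omega)
    exact ⟨insert b K, Finset.insert_subset hb hKT, by rw [Finset.card_insert_of_notMem hbK, hKj],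
      hfree⟩

end ColoredGraph

/-! ### The algorithm -/

namespace RAM

variable {α : Type}

/-- An instance of the problem. -/
structure Inst where
  n : ℕ
  k : ℕ
  G : SimpleGraph (Fin n)
  c : Fin n → ℕ

namespace Inst

variable (I : Inst)

/-- The input arrays. -/
noncomputable def mem : ℕ → ℕ → ℕ := (inputState I.G I.c I.k).mem

/-- A bound on the number of iterations of all loops of the algorithm. -/
def scale : ℕ := (I.n + 1) * (I.k ^ I.k + I.k + 1) ^ (I.k + 1)

/-- The map `π` restricts to an automorphism. -/
def Pres (π : ℕ → ℕ) : Prop :=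
  ∀ u < I.n, (π u < I.n ∧ I.mem 0 (π u) = I.mem 0 u) ∧
    ∀ v < I.n, (π u = π v → u = v) ∧ I.mem 1 (π u * I.n + π v) = I.mem 1 (u * I.n + v)

end Inst

/-- The transposition of two numbers. -/
def swapNat (u v w : ℕ) : ℕ := if w = u then v else if w = v then u else w

namespace Inst

variable (I : Inst)

/-- The vertex `v` cannot be swapped with a smaller one. -/
def Rep (v : ℕ) : Prop := ∀ u < v, ¬ I.Pres (swapNat u v)

open Classical in
/-- The number of representatives below `v`. -/
noncomputable def rank (v : ℕ) : ℕ := Nat.count I.Rep v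

/-- The number of representatives that are considered. -/
noncomputable def width : ℕ := if I.rank I.n ≤ I.k ^ I.k + I.k then I.rank I.n else I.k ^ I.k + I.k

/-- The representative of rank `j`. -/
noncomputable def vertex (j : ℕ) : ℕ := search (fun v => I.Rep v ∧ I.rank v = j) I.n

/-- The entry with index `i` of the tuple of vertices encoded by `N`. -/
noncomputable def entry (N i : ℕ) : ℕ := I.vertex (N / I.width ^ i % I.width)

/-- The map of the vertices in the tuple encoded by `N` that is encoded by `S`. -/
noncomputable def move (N S v : ℕ) : ℕ :=
  if search (fun i => I.entry N i = v) I.k < I.k then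
    I.entry N (S / I.k ^ search (fun i => I.entry N i = v) I.k % I.k)
  else v

/-- The entries of the tuple encoded by `N` form a set of `k` vertices that contains no support of
an automorphism. -/
def Good (N : ℕ) : Prop :=
  (∀ i < I.k, ∀ j < I.k, I.entry N i = I.entry N j → i = j) ∧
    ¬ ∃ S < I.k ^ I.k, I.Pres (I.move N S) ∧ ∃ v < I.n, ¬ I.move N S v = v

/-- The output of the algorithm. -/
def Answer : Prop := ∃ N < I.width ^ I.k, I.Good N

variable {I}

theorem n_le_scale : I.n ≤ I.scale := by
  unfold scale
  nlinarith [Nat.one_le_pow (I.k + 1) (I.k ^ I.k + I.k + 1) (by omega)]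

/-- The exponent `k + 1` in `scale` admits both `i = k`, for counting tuples, and `i = 1`, even when
`k = 0`. -/
theorem pow_le_scale {i : ℕ} (hi : i ≤ I.k + 1) : (I.k ^ I.k + I.k + 1) ^ i ≤ I.scale :=
  (Nat.pow_le_pow_right (by omega) hi).trans (Nat.le_mul_of_pos_left _ (by omega))

theorem k_le_scale : I.k ≤ I.scale :=
  le_trans (by rw [pow_one]; omega) (I.pow_le_scale (i := 1) (by omega))

theorem k_pow_le_scale : I.k ^ I.k ≤ I.scale :=
  le_trans (by rw [pow_one]; omega) (I.pow_le_scale (i := 1) (by omega))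

theorem width_le : I.width ≤ I.k ^ I.k + I.k := by
  unfold width; split_ifs <;> omega

theorem width_le_scale : I.width ≤ I.scale :=
  le_trans (by rw [pow_one]; have := I.width_le; omega) (I.pow_le_scale (i := 1) (by omega))

theorem width_pow_le_scale : I.width ^ I.k ≤ I.scale :=
  (Nat.pow_le_pow_left (I.width_le.trans (Nat.le_succ _)) _).trans
    (I.pow_le_scale (i := I.k) (by omega))

end Inst

/-! ### Each ingredient of the algorithm is computable in time polynomial in the scale. -/

/-- The context contains the instance `inst a`. -/
structure Ctx.Has (Γ : Ctx α) (inst : α → Inst) : Prop where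
  n : Cmp Γ fun a => (inst a).n
  k : Cmp Γ fun a => (inst a).k
  mem : ∀ a, Γ.mem a = (inst a).mem
  le : ∀ a, Γ.ok a → (inst a).scale ≤ Γ.bd a

namespace Ctx.Has

variable {Γ : Ctx α} {inst : α → Inst} (h : Γ.Has inst)
include h

theorem ext (b : α → ℕ) : (Γ.ext b).Has fun x => inst x.1 :=
  ⟨h.n.lift b, h.k.lift b, fun x => h.mem x.1, fun x hx => h.le x.1 hx.1⟩

theorem n_le (a : α) (ha : Γ.ok a) : (inst a).n ≤ Γ.bd a := Inst.n_le_scale.trans (h.le a ha)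

theorem k_le (a : α) (ha : Γ.ok a) : (inst a).k ≤ Γ.bd a := Inst.k_le_scale.trans (h.le a ha)

theorem load {f : α → ℕ} (hf : Cmp Γ f) (m : ℕ) : Cmp Γ fun a => (inst a).mem m (f a) :=
  (hf.load m).congr fun a _ => by rw [h.mem]

theorem pres {π : α → ℕ → ℕ} (hπ : Cmp (Γ.ext fun a => (inst a).n) fun x => π x.1 x.2) :
    Dec Γ fun a => (inst a).Pres (π a) := by
  have h1 := h.ext fun a => (inst a).n
  have h2 := h1.ext fun a => (inst a.1).n
  have hu := (Cmp.index Γ fun a => (inst a).n)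
  have hu' := hu.lift fun a => (inst a.1).n
  have hv := (Cmp.index (Γ.ext fun a => (inst a).n) fun a => (inst a.1).n)
  have hπu := hπ.lift fun a => (inst a.1).n
  have hπv := hπ.lift_inner (b' := fun a => (inst a).n) (b'' := fun a => (inst a.1).n)
    fun _ => le_rfl
  exact Dec.all h.n (((Dec.lt hπ h1.n).and (.eq (h1.load hπ 0) (h1.load hu 0))).and
    (Dec.all h1.n (((Dec.eq hπu hπv).imp (.eq hu' hv)).and
      (.eq (h2.load ((hπu.mul h2.n h2.n_le).add hπv) 1) (h2.load ((hu'.mul h2.n h2.n_le).add hv) 1)))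
      h1.n_le)) h.n_le

theorem rep {v : α → ℕ} (hv : Cmp Γ v) (hvn : ∀ a, Γ.ok a → v a ≤ (inst a).n) :
    Dec Γ fun a => (inst a).Rep (v a) := by
  have h1 := h.ext v
  have hw := Cmp.index (Γ.ext v) fun a => (inst a.1).n
  have hu := (Cmp.index Γ v).lift fun a => (inst a.1).n
  have hv' := (hv.lift v).lift fun a => (inst a.1).n
  exact Dec.all hv (h1.pres ((Cmp.ite (.eq hw hu) hv' (.ite (.eq hw hv') hu hw)).congr
    fun _ _ => by unfold swapNat; congr)).not fun a ha => (hvn a ha).trans (h.n_le a ha)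

theorem rank {v : α → ℕ} (hv : Cmp Γ v) (hvn : ∀ a, Γ.ok a → v a ≤ (inst a).n) :
    Cmp Γ fun a => (inst a).rank (v a) :=
  Cmp.count hv ((h.ext v).rep (.index Γ v) fun _ hx => hx.2.le.trans (hvn _ hx.1))
    fun a ha => (hvn a ha).trans (h.n_le a ha)

theorem k_pow : Cmp Γ fun a => (inst a).k ^ (inst a).k := h.k.pow h.k h.k_le h.k_le

theorem width : Cmp Γ fun a => (inst a).width := by
  have h1 := h.rank h.n fun _ _ => le_rfl
  have h2 := h.k_pow.add h.k
  exact (Cmp.ite (.le h1 h2) h1 h2).congr fun a _ => by unfold Inst.width; congr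

theorem vertex {j : α → ℕ} (hj : Cmp Γ j) : Cmp Γ fun a => (inst a).vertex (j a) := by
  have h1 := h.ext fun a => (inst a).n
  have h2 := Cmp.index Γ fun a => (inst a).n
  exact Cmp.search h.n ((h1.rep h2 fun x hx => hx.2.le).and
    (.eq (h1.rank h2 fun x hx => hx.2.le) (hj.lift _))) h.n_le

theorem entry {N i : α → ℕ} (hN : Cmp Γ N) (hi : Cmp Γ i) (hNB : ∀ a, Γ.ok a → N a ≤ Γ.bd a)
    (hiB : ∀ a, Γ.ok a → i a ≤ Γ.bd a) : Cmp Γ fun a => (inst a).entry (N a) (i a) :=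
  h.vertex (.digit hN h.width hi hNB (fun a ha => Inst.width_le_scale.trans (h.le a ha)) hiB)

theorem move {N S v : α → ℕ} (hN : Cmp Γ N) (hS : Cmp Γ S) (hv : Cmp Γ v)
    (hNB : ∀ a, Γ.ok a → N a ≤ Γ.bd a) (hSB : ∀ a, Γ.ok a → S a ≤ Γ.bd a) :
    Cmp Γ fun a => (inst a).move (N a) (S a) (v a) := by
  have h1 := Cmp.search (p := fun a i => (inst a).entry (N a) i = v a) h.k
    (.eq ((h.ext fun a => (inst a).k).entry (hN.lift _) (.index _ _)
    (fun x hx => hNB _ hx.1) fun x hx => hx.2.le.trans (h.k_le _ hx.1)) (hv.lift _)) h.k_le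
  have h2 := Cmp.digit hS h.k h1 hSB h.k_le fun a ha => (search_le _ _).trans (h.k_le a ha)
  exact (Cmp.ite (.lt h1 h.k) (h.entry hN h2 hNB fun a ha => (Nat.mod_le _ _).trans
    ((Nat.div_le_self _ _).trans (hSB a ha))) hv).congr fun a _ => by unfold Inst.move; congr

theorem good {N : α → ℕ} (hN : Cmp Γ N) (hNB : ∀ a, Γ.ok a → N a ≤ Γ.bd a) :
    Dec Γ fun a => (inst a).Good (N a) := by
  let bk : α → ℕ := fun a => (inst a).k
  let bS : α → ℕ := fun a => (inst a).k ^ (inst a).k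
  have hSB : ∀ a, Γ.ok a → bS a ≤ Γ.bd a := fun a ha => Inst.k_pow_le_scale.trans (h.le a ha)
  have h1 := h.ext bk
  have h2 := h1.ext fun x => bk x.1
  have e1 := h2.entry ((hN.lift bk).lift fun x => bk x.1) ((Cmp.index Γ bk).lift fun x => bk x.1)
    (fun x hx => hNB _ hx.1.1) fun x hx => hx.1.2.le.trans (h.k_le _ hx.1.1)
  have e2 := h2.entry ((hN.lift bk).lift fun x => bk x.1) (Cmp.index (Γ.ext bk) fun x => bk x.1)
    (fun x hx => hNB _ hx.1.1) fun x hx => hx.2.le.trans (h.k_le _ hx.1.1)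
  have d1 := Dec.all (p := fun a i => ∀ j < (inst a).k,
    (inst a).entry (N a) i = (inst a).entry (N a) j → i = j)
    h.k (Dec.all h1.k ((Dec.eq e1 e2).imp
    (.eq ((Cmp.index Γ bk).lift fun x => bk x.1) (Cmp.index (Γ.ext bk) fun x => bk x.1))) h1.k_le)
    h.k_le
  have h3 := h.ext bS
  have m1 := (h3.ext fun x => (inst x.1).n).move ((hN.lift bS).lift fun x => (inst x.1).n)
    ((Cmp.index Γ bS).lift fun x => (inst x.1).n) (Cmp.index (Γ.ext bS) fun x => (inst x.1).n)
    (fun x hx => hNB _ hx.1.1) fun x hx => hx.1.2.le.trans (hSB _ hx.1.1)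
  have d2 := Dec.exists (p := fun a S => (inst a).Pres ((inst a).move (N a) S) ∧
    ∃ v < (inst a).n, ¬ (inst a).move (N a) S v = v) h.k_pow ((h3.pres m1).and
      (Dec.exists h3.n (Dec.eq m1 (.index _ _)).not h3.n_le)) hSB
  exact d1.and d2.not

theorem answer : Dec Γ fun a => (inst a).Answer := by
  have hB : ∀ a, Γ.ok a → (inst a).width ^ (inst a).k ≤ Γ.bd a := fun a ha =>
    Inst.width_pow_le_scale.trans (h.le a ha)
  exact Dec.exists (h.width.pow h.k (fun a ha => Inst.width_le_scale.trans (h.le a ha)) h.k_le)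
    ((h.ext _).good (.index _ _) fun x hx => hx.2.le.trans (hB _ hx.1)) hB

end Ctx.Has

end RAM

/-! ### Correctness of the algorithm -/

namespace RAM.Inst

open ColoredGraph

variable {I : Inst}

theorem mem_zero (v : Fin I.n) : I.mem 0 v = I.c v := by
  simp [mem, inputState]

open Classical in
theorem mem_one (u v : Fin I.n) : I.mem 1 (u * I.n + v) = if I.G.Adj u v then 1 else 0 := by
  have h : (∃ u' v' : Fin I.n, (u * I.n + v : ℕ) = u' * I.n + v' ∧ I.G.Adj u' v') ↔
      I.G.Adj u v := by
    refine ⟨?_, fun h => ⟨u, v, rfl, h⟩⟩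
    rintro ⟨u', v', h, hadj⟩
    have hn : 0 < I.n := u.pos
    have h1 := congrArg (· / I.n) h
    have h2 := congrArg (· % I.n) h
    simp only [Nat.mul_comm _ I.n, Nat.mul_add_div hn, Nat.div_eq_of_lt v.2, Nat.div_eq_of_lt v'.2,
      Nat.mul_add_mod, Nat.mod_eq_of_lt v.2, Nat.mod_eq_of_lt v'.2, add_zero] at h1 h2
    rwa [Fin.ext h1, Fin.ext h2]
  simp only [mem, inputState, one_ne_zero, if_false, if_true, h]

/-- Injectivity suffices for a permutation because the vertex set is finite. -/
theorem pres_iff {π : ℕ → ℕ} :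
    I.Pres π ↔ ∃ g : Equiv.Perm (Fin I.n), (∀ v, (g v : ℕ) = π v) ∧ IsAut I.G I.c g := by
  classical
  have hadj : ∀ u v u' v' : Fin I.n, I.mem 1 (u * I.n + v) = I.mem 1 (u' * I.n + v') ↔
      (I.G.Adj u v ↔ I.G.Adj u' v') := by
    intro u v u' v'
    rw [mem_one, mem_one]
    by_cases h : I.G.Adj u v <;> by_cases h' : I.G.Adj u' v' <;> simp [h, h']
  constructor
  · intro h
    let f : Fin I.n → Fin I.n := fun v => ⟨π v, (h v v.2).1.1⟩
    have hf : Function.Injective f := fun u v huv =>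
      Fin.ext (((h u u.2).2 v v.2).1 (congrArg Fin.val huv))
    refine ⟨Equiv.ofBijective f (Finite.injective_iff_bijective.1 hf), fun _ => rfl,
      fun u v => (hadj _ _ _ _).1 ((h u u.2).2 v v.2).2, fun v => ?_⟩
    rw [← mem_zero, ← mem_zero]
    exact (h v v.2).1.2
  · rintro ⟨g, hg, haut⟩ u hu
    have h1 := hg ⟨u, hu⟩
    refine ⟨⟨h1 ▸ (g _).2, ?_⟩, fun v hv => ?_⟩
    · rw [← h1, mem_zero, haut.2, ← mem_zero]
    · have h2 := hg ⟨v, hv⟩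
      refine ⟨fun h => ?_, ?_⟩
      · rw [← h1, ← h2] at h
        exact congrArg Fin.val (g.injective (Fin.ext h))
      · rw [← h1, ← h2]
        exact (hadj _ _ ⟨u, hu⟩ ⟨v, hv⟩).2 (haut.1 _ _)

theorem pres_swapNat_iff {u v : Fin I.n} :
    I.Pres (swapNat u v) ↔ IsAut I.G I.c (Equiv.swap u v) := by
  have h : ∀ w : Fin I.n, (Equiv.swap u v w : ℕ) = swapNat u v w := by
    intro w
    simp only [Equiv.swap_apply_def, swapNat, Fin.ext_iff]
    split_ifs <;> rfl
  rw [pres_iff]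
  constructor
  · rintro ⟨g, hg, haut⟩
    convert haut
    exact Equiv.ext fun w => Fin.ext ((h w).trans (hg w).symm)
  · exact fun haut => ⟨_, h, haut⟩

theorem rep_iff {v : Fin I.n} : I.Rep v ↔ ∀ u < v, ¬ IsAut I.G I.c (Equiv.swap u v) := by
  constructor
  · exact fun h u hu => mt pres_swapNat_iff.2 (h u hu)
  · exact fun h u hu => mt (pres_swapNat_iff (u := ⟨u, hu.trans v.2⟩)).1 (h ⟨u, hu.trans v.2⟩ hu)

theorem exists_rep_of_lt_rank {n j : ℕ} (h : j < I.rank n) :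
    ∃ v < n, I.Rep v ∧ I.rank v = j := by
  classical
  induction n with
  | zero => simp [rank] at h
  | succ n ih =>
    by_cases hj : j < I.rank n
    · obtain ⟨v, hv, h'⟩ := ih hj
      exact ⟨v, by omega, h'⟩
    · unfold rank at h hj
      rw [Nat.count_succ] at h
      split_ifs at h with h1
      · exact ⟨n, by omega, h1, by unfold rank; omega⟩
      · omega

theorem rank_injective {u v : ℕ} (hu : I.Rep u) (hv : I.Rep v) (h : I.rank u = I.rank v) :
    u = v := by
  classical
  exact Nat.count_injective hu hv h

theorem width_le_rank : I.width ≤ I.rank I.n := by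
  unfold width; split_ifs <;> omega

theorem vertex_spec {j : ℕ} (h : j < I.width) :
    I.vertex j < I.n ∧ I.Rep (I.vertex j) ∧ I.rank (I.vertex j) = j := by
  obtain ⟨v, hv, h'⟩ := exists_rep_of_lt_rank (h.trans_le I.width_le_rank)
  have := search_lt (p := fun v => I.Rep v ∧ I.rank v = j) hv h'
  exact ⟨this, search_spec this⟩

theorem vertex_rank {v : ℕ} (hv : I.Rep v) (h : I.rank v < I.width) : I.vertex (I.rank v) = v :=
  have h1 := (vertex_spec h).2
  rank_injective h1.1 hv h1.2

/-- The inverse of `finFunctionFinEquiv` reads off exactly the digits used in `entry`, whence the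
closing `rfl`. -/
theorem entry_finFunctionFinEquiv (f : Fin I.k → Fin I.width) (i : Fin I.k) :
    I.entry (finFunctionFinEquiv f) i = I.vertex (f i) := by
  have h := congrFun (finFunctionFinEquiv.symm_apply_apply f) i
  rw [entry, ← h]; rfl

theorem entry_lt {N i : ℕ} (hN : N < I.width ^ I.k) (hi : i < I.k) : I.entry N i < I.n := by
  refine (vertex_spec (Nat.mod_lt _ (Nat.pos_of_ne_zero fun h => ?_))).1
  rw [h, zero_pow (by omega)] at hN
  omega

theorem move_of_forall_ne {N S v : ℕ} (h : ∀ i < I.k, I.entry N i ≠ v) : I.move N S v = v :=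
  if_neg fun h' => h _ h' (search_spec (p := fun i => I.entry N i = v) h')

theorem move_finFunctionFinEquiv {N : ℕ} (s : Fin I.k → Fin I.k)
    (hinj : ∀ i < I.k, ∀ j < I.k, I.entry N i = I.entry N j → i = j) (i : Fin I.k) :
    I.move N (finFunctionFinEquiv s) (I.entry N i) = I.entry N (s i) := by
  have h1 := search_lt (p := fun j => I.entry N j = I.entry N i) i.2 rfl
  have h2 := hinj _ h1 _ i.2 (search_spec (p := fun j => I.entry N j = I.entry N i) h1)
  have h3 := congrFun (finFunctionFinEquiv.symm_apply_apply s) i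
  rw [move, if_pos h1, h2, ← h3]; rfl

theorem nSubKRigid_of_answer (h : I.Answer) : NSubKRigid I.G I.c I.k := by
  classical
  obtain ⟨N, hN, hinj, hgood⟩ := h
  let t : Fin I.k → Fin I.n := fun i => ⟨I.entry N i, entry_lt hN i.2⟩
  have ht : Function.Injective t := fun i j hij =>
    Fin.ext (hinj i i.2 j j.2 (congrArg Fin.val hij))
  refine nSubKRigid_iff.2 ⟨Finset.univ.image t, by simp [Finset.card_image_of_injective _ ht],
    fun π hπ hfix => ?_⟩
  -- A value outside the tuple would be fixed by `π`, hence equal to its argument `t i`, which lies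
  -- in the tuple.
  have hmem : ∀ i, ∃ j, t j = π (t i) := by
    intro i
    by_contra! hne
    have h1 : π (t i) ∉ Finset.univ.image t := by simpa using hne
    exact hne i (π.injective (hfix _ h1)).symm
  choose s hs using hmem
  have hmove : ∀ v : Fin I.n, (π v : ℕ) = I.move N (finFunctionFinEquiv s) v := by
    intro v
    by_cases hv : ∃ i, t i = v
    · obtain ⟨i, rfl⟩ := hv
      rw [move_finFunctionFinEquiv s hinj, ← hs]
    · push Not at hv
      rw [hfix v (by simpa using hv), move_of_forall_ne]
      exact fun i hi h => hv ⟨i, hi⟩ (Fin.ext h)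
  by_contra hne
  refine hgood ⟨_, (finFunctionFinEquiv s).2, pres_iff.2 ⟨π, hmove, hπ⟩, ?_⟩
  by_contra! hv
  exact hne (Equiv.ext fun v => Fin.ext ((hmove v).trans (hv v v.2)))

/-- If all representatives are considered, a given free set is pushed down to representatives; if
the list is truncated, its `k ^ k + k` members are pairwise non-twins and the greedy construction
applies. -/
theorem exists_isFree_rank_lt_width (h : NSubKRigid I.G I.c I.k) :
    ∃ K : Finset (Fin I.n), K.card = I.k ∧ IsFree I.G I.c K ∧
      ∀ v ∈ K, I.Rep v ∧ I.rank v < I.width := by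
  classical
  by_cases hw : I.rank I.n ≤ I.k ^ I.k + I.k
  · obtain ⟨K, hK, hfree⟩ := nSubKRigid_iff.1 h
    obtain ⟨K', h1, h2, h3⟩ := exists_isFree_forall_not_isAut_swap hfree
    refine ⟨K', h1.trans hK, h2, fun v hv => ⟨rep_iff.2 (h3 v hv), ?_⟩⟩
    rw [width, if_pos hw]
    exact Nat.count_strict_mono (rep_iff.2 (h3 v hv)) v.2
  · let t : Fin I.width → Fin I.n := fun j => ⟨I.vertex j, (vertex_spec j.2).1⟩
    have ht : Function.Injective t := fun i j hij => by
      have := congrArg (fun v : Fin I.n => I.rank v) hij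
      simp only [t, (vertex_spec i.2).2.2, (vertex_spec j.2).2.2] at this
      exact Fin.ext this
    have hrep : ∀ v ∈ Finset.univ.image t, I.Rep v ∧ I.rank v < I.width := by
      simp only [Finset.mem_image, Finset.mem_univ, true_and, forall_exists_index,
        forall_apply_eq_imp_iff]
      intro j
      have h1 := vertex_spec j.2
      exact ⟨h1.2.1, h1.2.2.trans_lt j.2⟩
    have htwin : ∀ u ∈ Finset.univ.image t, ∀ v ∈ Finset.univ.image t,
        IsAut I.G I.c (@Equiv.swap _ (Classical.decEq _) u v) → u = v := by
      intro u hu v hv hs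
      by_contra hne
      rcases lt_or_gt_of_ne hne with hlt | hlt
      · exact rep_iff.1 (hrep v hv).1 u hlt (by convert hs)
      · exact rep_iff.1 (hrep u hu).1 v hlt (by rw [Equiv.swap_comm]; convert hs)
    obtain ⟨K, hK, hcard, hfree⟩ := exists_isFree_card_eq (G := I.G) (c := I.c) (k := I.k)
      (T := Finset.univ.image t) htwin
      (by rw [Finset.card_image_of_injective _ ht, Finset.card_univ, Fintype.card_fin, width,
        if_neg hw])
    exact ⟨K, hcard, hfree, fun v hv => hrep v (hK hv)⟩

theorem answer_of_nSubKRigid (h : NSubKRigid I.G I.c I.k) : I.Answer := by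
  obtain ⟨K, hcard, hfree, hK⟩ := exists_isFree_rank_lt_width h
  let e : Fin I.k ≃ K := (finCongr hcard.symm).trans K.equivFin.symm
  let f : Fin I.k → Fin I.width := fun i => ⟨I.rank (e i).1, (hK _ (e i).2).2⟩
  have hentry : ∀ i : Fin I.k, I.entry (finFunctionFinEquiv f) i = (e i).1 := fun i => by
    rw [entry_finFunctionFinEquiv]
    exact vertex_rank (hK _ (e i).2).1 (hK _ (e i).2).2
  refine ⟨_, (finFunctionFinEquiv f).2, fun i hi j hj hij => ?_, ?_⟩
  · rw [hentry ⟨i, hi⟩, hentry ⟨j, hj⟩] at hij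
    exact congrArg Fin.val (e.injective (Subtype.ext (Fin.ext hij)))
  · rintro ⟨S, -, hpres, v, hv, hne⟩
    obtain ⟨g, hg, haut⟩ := pres_iff.1 hpres
    -- A map of the form `move` fixes everything outside the tuple, so freeness applies.
    have h1 : g = 1 := by
      refine hfree g haut fun w hw => Fin.ext ?_
      rw [hg, move_of_forall_ne]
      intro i hi h2
      rw [hentry ⟨i, hi⟩] at h2
      exact hw (Fin.ext h2 ▸ (e ⟨i, hi⟩).2)
    have := hg ⟨v, hv⟩
    rw [h1] at this
    exact hne this.symm

/-! ### Running time and assembly of the program. -/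

/-- The running time in terms of `n` and `k`. -/
theorem scale_add_two_pow_le (c : ℕ) : ∃ C, ∀ I : Inst,
    (I.scale + 2) ^ c + 2 ≤ C * I.k ^ (C * I.k ^ 2) * (I.n + 1) ^ C := by
  -- The factor `9` is forced by `k = 1`; for `k ≥ 2` one has `(k + 2) * (k + 1) ≤ 4 * k ^ 2`.
  have hbase : ∀ k : ℕ, (k ^ k + k + 1) ^ (k + 1) ≤ 9 * k ^ (4 * k ^ 2) := by
    intro k
    rcases k with _ | _ | k
    · norm_num
    · norm_num
    · generalize hk : k + 1 + 1 = K
      have h2 : 2 ≤ K := by omega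
      have h1 : K ^ K + K + 1 ≤ K ^ (K + 2) := by
        have h3 : K ≤ K ^ K := Nat.le_self_pow (by omega) K
        have h4 : 2 ^ 2 ≤ K ^ 2 := Nat.pow_le_pow_left h2 2
        rw [pow_add]
        nlinarith
      calc (K ^ K + K + 1) ^ (K + 1) ≤ (K ^ (K + 2)) ^ (K + 1) := Nat.pow_le_pow_left h1 _
        _ = K ^ ((K + 2) * (K + 1)) := (pow_mul _ _ _).symm
        _ ≤ K ^ (4 * K ^ 2) := Nat.pow_le_pow_right (by omega) (by nlinarith)
        _ ≤ 9 * K ^ (4 * K ^ 2) := by omega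
  -- `27 = 3 * 9`, as adding `2` to a positive number at most triples it; the outer `3` arises
  -- likewise. The sum dominates the coefficient and both exponents.
  refine ⟨3 * 27 ^ c + 4 * c, fun I => ?_⟩
  have hW := hbase I.k
  have h2 : 1 ≤ (I.k ^ I.k + I.k + 1) ^ (I.k + 1) := Nat.one_le_pow _ _ (by omega)
  have hpos : 1 ≤ I.k ^ (4 * I.k ^ 2) := by omega
  have hle : I.scale + 2 ≤ 27 * (I.n + 1) * I.k ^ (4 * I.k ^ 2) := by
    have h1 := Nat.mul_le_mul_left (I.n + 1) hW
    have h3 := Nat.mul_le_mul_left (I.n + 1) h2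
    unfold scale
    nlinarith
  have hpow : I.k ^ (4 * I.k ^ 2 * c) ≤ I.k ^ ((3 * 27 ^ c + 4 * c) * I.k ^ 2) := by
    rcases Nat.eq_zero_or_pos I.k with h | h
    · simp [h]
    · exact Nat.pow_le_pow_right h (by nlinarith [Nat.zero_le (27 ^ c * I.k ^ 2)])
  have hn : (I.n + 1) ^ c ≤ (I.n + 1) ^ (3 * 27 ^ c + 4 * c) :=
    Nat.pow_le_pow_right (by omega) (by omega)
  have h27 : 1 ≤ (27 * (I.n + 1) * I.k ^ (4 * I.k ^ 2)) ^ c :=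
    Nat.one_le_pow _ _ (by positivity)
  calc (I.scale + 2) ^ c + 2 ≤ 3 * (27 * (I.n + 1) * I.k ^ (4 * I.k ^ 2)) ^ c := by
        have := Nat.pow_le_pow_left hle c
        omega
    _ = 3 * 27 ^ c * I.k ^ (4 * I.k ^ 2 * c) * (I.n + 1) ^ c := by
        rw [mul_pow, mul_pow, ← pow_mul]; ring
    _ ≤ _ := Nat.mul_le_mul (Nat.mul_le_mul (by omega) hpow) hn

/-- The context in which the input is given. -/
noncomputable def inputCtx : Ctx Inst where
  vars := {Inst.n, Inst.k}
  mem := Inst.mem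
  bd := Inst.scale
  ok _ := True

theorem inputCtx_has : inputCtx.Has id where
  n := .var (.inl rfl)
  k := .var (.inr rfl)
  mem _ := rfl
  le _ _ := le_rfl

end RAM.Inst

open RAM in
theorem mainTheorem6 :
    ∃ (p : RAM.Prog) (C : ℕ), ∀ (n k : ℕ) (G : SimpleGraph (Fin n)) (c : Fin n → ℕ),
      RAM.DecidesWithin p G c k (ColoredGraph.NSubKRigid G c k)
        (C * k ^ (C * k ^ 2) * (n + 1) ^ C) := by
  classical
  obtain ⟨p, c, hp⟩ := Inst.inputCtx_has.answer (fun f => if f = Inst.n then 0 else 1) 2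
    (fun f _ => by split_ifs <;> omega)
  obtain ⟨C, hC⟩ := Inst.scale_add_two_pow_le c
  refine ⟨.seq p (.assign 0 (.reg 2)), C, fun n k G col => ?_⟩
  let I : Inst := ⟨n, k, G, col⟩
  obtain ⟨t, s, hs, ht, -, -, hv⟩ := hp I (inputState G col k) ⟨trivial, rfl, by
    rintro f (rfl | rfl)
    · exact congrArg _ (if_pos rfl)
    -- Were the two functions equal, register `0` would serve for both, so this case need not be
    -- refuted.
    · by_cases h : Inst.k = Inst.n
      · exact (congrArg _ (if_pos h)).trans (congrFun h I).symm
      · exact congrArg _ (if_neg h)⟩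
  refine ⟨_, _, .seq hs (.assign s 0 (.reg 2)), (Nat.add_le_add_right ht 2).trans (hC I),
    fun h => ?_, fun h => ?_⟩
  all_goals rw [State.setReg_reg_self]; refine hv.trans ?_
  · exact if_pos (Inst.answer_of_nSubKRigid (I := I) h)
  · exact if_neg (mt (Inst.nSubKRigid_of_answer (I := I)) h)
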